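/- For $r\in\mathbb{N}$ and a symmetric matrix $Q\in\mathbb{R}^{r\times r}$, let $\mathcal{D}_Q$ be the distribution on $\mathbb{R}$ of $x^\top Q x$, where $x\sim\mathcal{N}(0,\mathrm{Id}_r)$ (the one-dimensional degree-2 transformation with seed length $r$ specified by $Q$). For $Q,Q'\in\mathbb{R}^{r\times r}$ let $d_{\mathsf G}(Q,Q')=\min_{U\in O(r)}\|UQU^\top-Q'\|_F$ be the parameter distance. A (possibly randomized) algorithm that receives $n$ i.i.d. samples from $\mathcal{D}_Q$ and outputs $\widehat Q\in\mathbb{R}^{r\times r}$ parameter learns $\mathcal{D}_Q$ to error $\varepsilon$ with failure probability $\delta$ if $d_{\mathsf G}(Q,\widehat Q)\le\varepsilon$ with probability at least $1-\delta$. **Theorem B.1.** Parameter learning one-dimensional quadratic transformations of Gaussians with seed length $r$ and polynomially bounded operator norm to error $O(1)$ requires $\exp(\Omega(r))$ samples in the worst case. Precisely: for every integer $k\ge 1$ and every constant $\varepsilon>0$ there is a constant $c>0$ such that for every $\delta\in(0,1/2)$ the following holds for all sufficiently large $r$. If an algorithm using $n$ samples parameter learns $\mathcal{D}_Q$ to error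 $\varepsilon$ with failure probability $\delta$ for every symmetric $Q\in\mathbb{R}^{r\times r}$ with operator norm $\|Q\|_{\mathsf{op}}\le r^k$, then $n\ge\exp(cr)$. -/

import Mathlib

open MeasureTheory ProbabilityTheory
open scoped Matrix

/-- The one-dimensional degree-2 transformation with seed length `r` specified by `Q`: the law of
the quadratic form `xᵀ Q x = ∑ i j, Q i j * x i * x j`, where `x` is a standard Gaussian vector. -/
noncomputable def quadTransformation {r : ℕ} (Q : Matrix (Fin r) (Fin r) ℝ) : Measure ℝ :=
  (Measure.pi fun _ : Fin r => gaussianReal 0 1).map fun x => x ⬝ᵥ (Q *ᵥ x)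

/-- The Frobenius norm of a real square matrix. -/
noncomputable def frobNorm {r : ℕ} (M : Matrix (Fin r) (Fin r) ℝ) : ℝ :=
  Real.sqrt (∑ i, ∑ j, M i j ^ 2)

/-- The parameter distance of two networks consisting of a single quadratic form: the Frobenius
distance minimized over the gauge group `O(r)` acting by `Q ↦ U Q Uᵀ`. (The infimum is attained
because `O(r)` is compact.) -/
noncomputable def paramDist {r : ℕ} (Q Q' : Matrix (Fin r) (Fin r) ℝ) : ℝ :=
  ⨅ U : Matrix.orthogonalGroup (Fin r) ℝ, frobNorm (U.1 * Q * U.1ᵀ - Q')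

/-- The (symmetric) quadratic forms in `r` variables of operator norm at most `r ^ k`; they specify
the family of transformations with seed length `r` and polynomially bounded operator norm. -/
def boundedForms (r k : ℕ) : Set (Matrix (Fin r) (Fin r) ℝ) :=
  {Q | Q.IsSymm ∧ ‖Matrix.toEuclideanCLM (n := Fin r) (𝕜 := ℝ) Q‖ ≤ (r : ℝ) ^ k}

/-- The usual (entrywise product, i.e. Borel) measurable structure on real square matrices. -/
instance matrixMeasurableSpace (r : ℕ) : MeasurableSpace (Matrix (Fin r) (Fin r) ℝ) :=
  inferInstanceAs (MeasurableSpace (Fin r → Fin r → ℝ))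

/-- A possibly randomized algorithm that sees `n` real samples and outputs an `r × r` matrix is a
Markov kernel `A`. It parameter learns the transformation specified by `Q` to error `ε` with failure
probability at most `δ` if on `n` i.i.d. samples its output is, with probability at least `1 - δ`
over the samples and the algorithm's own randomness, at parameter distance at most `ε` from `Q`. -/
def ParamLearns {r n : ℕ} (A : Kernel (Fin n → ℝ) (Matrix (Fin r) (Fin r) ℝ)) (ε δ : ℝ)
    (Q : Matrix (Fin r) (Fin r) ℝ) : Prop :=
  1 - δ ≤ ((Measure.pi fun _ : Fin n => quadTransformation Q).bind A).real
    {Q' | paramDist Q Q' ≤ ε}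

/-! The proof exhibits two diagonal forms that are far apart in parameter distance but whose laws
are exponentially close, and applies Le Cam's two-point method.

If every nonzero eigenvalue has even multiplicity, the characteristic function is the inverse of a
polynomial in `τ = 2it`. For `s = 0, 1` take the nodes `3A + 2A cos((2j + s)π/m)`. By the
factorization of Chebyshev polynomials the polynomials `P_s = ∏ (1 - λτ)` differ only by `4(Aτ)^m`.
Both forms also get `m` double eigenvalues `6A`, which contribute `u^m` with `u = (1 - 6Aτ)⁻¹`.
Since `6Aτu = u - 1`, the characteristic functions differ by `4 · 6^(-m) (u - 1)^m / (P_0 P_1)`.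
Expanded binomially, this is a combination of characteristic functions of probability laws with
total weight `4 · 3^(-m)` (`charFun_paddedNodes_sub`), so `n` samples distinguish the forms by at
most `4n · 3^(-m)`.

With `m = 4l`, `3A` is an eigenvalue of the first form and at distance at least `A/l` from the
spectrum of the second. Taking `A = r/6` and `l` a small constant multiple of `r` makes this gap
exceed `2ε`, while `3^m` is exponential in `r`. -/

/-! ### Characteristic functions of Gaussian quadratic forms -/

/-- The characteristic function of the square of a standard Gaussian variable. -/
noncomputable def charFunSq (u : ℝ) : ℂ :=
  ∫ x, Complex.exp (u * (x : ℂ) ^ 2 * Complex.I) ∂gaussianReal 0 1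

lemma charFunSq_zero : charFunSq 0 = 1 := by simp [charFunSq]

/-- Squaring removes the branch of the complex square root; this is why eigenvalues are taken in
pairs below. -/
lemma charFunSq_sq (u : ℝ) : charFunSq u ^ 2 = (1 - 2 * u * Complex.I)⁻¹ := by
  have hb : 0 < ((1 : ℂ) / 2 - u * Complex.I).re := by simp
  have h : charFunSq u = ((Real.sqrt (2 * Real.pi))⁻¹ : ℝ) *
      ((Real.pi : ℂ) / (1 / 2 - u * Complex.I)) ^ (1 / 2 : ℂ) := by
    rw [charFunSq, integral_gaussianReal_eq_integral_smul one_ne_zero,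
      ← integral_gaussian_complex hb, ← integral_const_mul]
    congr 1 with x
    rw [gaussianPDFReal, Complex.real_smul]
    rw [Complex.ofReal_mul, mul_assoc, Complex.ofReal_exp, ← Complex.exp_add]
    congr 2
    · simp
    · push_cast
      ring
  have hsq : (((Real.sqrt (2 * Real.pi))⁻¹ : ℝ) : ℂ) ^ 2 = (2 * Real.pi : ℂ)⁻¹ := by
    rw [← Complex.ofReal_pow, inv_pow, Real.sq_sqrt (by positivity)]
    push_cast
    rfl
  have hpi : (Real.pi : ℂ) ≠ 0 := by exact_mod_cast Real.pi_ne_zero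
  have hne' : (1 : ℂ) / 2 - u * Complex.I ≠ 0 := fun h => by rw [h] at hb; simp at hb
  rw [h, mul_pow, hsq, ← Complex.cpow_nat_mul]
  norm_num
  rw [show (1 : ℂ) - 2 * u * Complex.I = 2 * (1 / 2 - u * Complex.I) by ring]
  field_simp

/-- The law of `∑ i, d i * x i ^ 2`, where `x` is a standard Gaussian vector. -/
noncomputable def weightedSqLaw {ι : Type*} [Fintype ι] (d : ι → ℝ) : Measure ℝ :=
  (Measure.pi fun _ : ι => gaussianReal 0 1).map fun x => ∑ i, d i * x i ^ 2

lemma measurable_sum_mul_sq {ι : Type*} [Fintype ι] (d : ι → ℝ) :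
    Measurable fun x : ι → ℝ => ∑ i, d i * x i ^ 2 :=
  Finset.measurable_sum _ fun i _ => measurable_const.mul ((measurable_pi_apply i).pow_const 2)

instance {ι : Type*} [Fintype ι] (d : ι → ℝ) : IsProbabilityMeasure (weightedSqLaw d) :=
  Measure.isProbabilityMeasure_map (measurable_sum_mul_sq d).aemeasurable

lemma charFun_weightedSqLaw {ι : Type*} [Fintype ι] (d : ι → ℝ) (t : ℝ) :
    charFun (weightedSqLaw d) t = ∏ i, charFunSq (t * d i) := by
  rw [charFun_apply_real, weightedSqLaw, integral_map (measurable_sum_mul_sq d).aemeasurable (by fun_prop)]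
  simp_rw [charFunSq]
  rw [← integral_fintype_prod_eq_prod]
  congr 1 with x
  rw [← Complex.exp_sum]
  congr 1
  push_cast
  rw [Finset.mul_sum, Finset.sum_mul]
  exact Finset.sum_congr rfl fun i _ => by ring

lemma prod_charFunSq_fin_two {ι : Type*} [Fintype ι] (d : ι → ℝ) (t : ℝ) :
    ∏ p : ι × Fin 2, charFunSq (t * d p.1) = ∏ i, (1 - d i * (2 * t * Complex.I))⁻¹ := by
  rw [Fintype.prod_prod_type]
  refine Finset.prod_congr rfl fun i _ => ?_
  rw [Fin.prod_univ_two, ← sq, charFunSq_sq]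
  congr 2
  push_cast
  ring

lemma quadTransformation_diagonal {r : ℕ} (d : Fin r → ℝ) :
    quadTransformation (Matrix.diagonal d) = weightedSqLaw d := by
  rw [quadTransformation, weightedSqLaw]
  congr 1 with x
  rw [dotProduct]
  exact Finset.sum_congr rfl fun i _ => by rw [Matrix.mulVec_diagonal]; ring

/-! ### Chebyshev products -/

/-- Each factor times `z` is `(z - e^{iθ})(z - e^{-iθ})`. As `θ` runs over the shifted angles,
`e^{iθ}` and `e^{-iθ}` run over rotated `m`-th roots of unity, so the product is `(z^m -
e^{ima})(z^m - e^{-ima})`. -/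
lemma prod_add_inv_sub_two_cos {m : ℕ} (hm : 0 < m) (a z : ℂ) (hz : z ≠ 0) :
    ∏ j ∈ Finset.range m, (z + z⁻¹ - 2 * Complex.cos (a + 2 * Real.pi * j / m)) =
      z ^ m + z⁻¹ ^ m - 2 * Complex.cos (m * a) := by
  set ζ := Complex.exp (2 * Real.pi * Complex.I / m) with hζ
  have hp : IsPrimitiveRoot ζ m := Complex.isPrimitiveRoot_exp m hm.ne'
  have key : ∀ {ξ : ℂ}, IsPrimitiveRoot ξ m → ∀ x y : ℂ,
      x ^ m - y ^ m = ∏ j ∈ Finset.range m, (x - ξ ^ j * y) := by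
    intro ξ hξ x y
    rw [hξ.pow_sub_pow_eq_prod_sub_mul x y hm]
    symm
    refine Finset.prod_nbij (fun j => ξ ^ j) ?_ ?_ ?_ fun _ _ => rfl
    · intro j _
      rw [Polynomial.mem_nthRootsFinset hm, ← pow_mul, mul_comm, pow_mul, hξ.pow_eq_one, one_pow]
    · intro i hi j hj h
      exact hξ.pow_inj (by simpa using hi) (by simpa using hj) h
    · intro x hx
      have hx' := (Polynomial.mem_nthRootsFinset hm _).1 hx
      have : NeZero m := ⟨hm.ne'⟩
      obtain ⟨i, hi, rfl⟩ := hξ.eq_pow_of_pow_eq_one hx'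
      exact ⟨i, by simpa using hi, rfl⟩
  have h1 := key hp z (Complex.exp (a * Complex.I))
  have h2 := key hp.inv z (Complex.exp (-a * Complex.I))
  have hz' : z ^ m ≠ 0 := pow_ne_zero _ hz
  refine mul_left_cancel₀ hz' ?_
  calc z ^ m * ∏ j ∈ Finset.range m, (z + z⁻¹ - 2 * Complex.cos (a + 2 * Real.pi * j / m))
      = ∏ j ∈ Finset.range m, ((z - ζ ^ j * Complex.exp (a * Complex.I)) *
          (z - ζ⁻¹ ^ j * Complex.exp (-a * Complex.I))) := by
        rw [← Finset.card_range m, ← Finset.prod_const, Finset.card_range,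
          ← Finset.prod_mul_distrib]
        refine Finset.prod_congr rfl fun j _ => ?_
        have e1 : ζ ^ j * Complex.exp (a * Complex.I) =
            Complex.exp ((a + 2 * Real.pi * j / m) * Complex.I) := by
          rw [hζ, ← Complex.exp_nat_mul, ← Complex.exp_add]
          congr 1
          ring
        have e2 : ζ⁻¹ ^ j * Complex.exp (-a * Complex.I) =
            Complex.exp (-(a + 2 * Real.pi * j / m) * Complex.I) := by
          rw [hζ, ← Complex.exp_neg, ← Complex.exp_nat_mul, ← Complex.exp_add]
          congr 1
          ring
        have e3 : Complex.exp ((a + 2 * Real.pi * j / m) * Complex.I) *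
            Complex.exp (-(a + 2 * Real.pi * j / m) * Complex.I) = 1 := by
          rw [← Complex.exp_add, neg_mul, add_neg_cancel, Complex.exp_zero]
        rw [e1, e2, Complex.two_cos]
        linear_combination (-1 : ℂ) * e3 + mul_inv_cancel₀ hz
    _ = (z ^ m - Complex.exp (a * Complex.I) ^ m) *
          (z ^ m - Complex.exp (-a * Complex.I) ^ m) := by
        rw [Finset.prod_mul_distrib, h1, h2]
    _ = _ := by
        have e3 : Complex.exp (m * a * Complex.I) * Complex.exp (-(m * a) * Complex.I) = 1 := by
          rw [← Complex.exp_add]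
          simp
        have e1 : Complex.exp (a * Complex.I) ^ m = Complex.exp (m * a * Complex.I) := by
          rw [← Complex.exp_nat_mul]
          congr 1
          ring
        have e2 : Complex.exp (-a * Complex.I) ^ m = Complex.exp (-(m * a) * Complex.I) := by
          rw [← Complex.exp_nat_mul]
          congr 1
          ring
        have e4 : z ^ m * z⁻¹ ^ m = 1 := by rw [← mul_pow, mul_inv_cancel₀ hz, one_pow]
        rw [e1, e2, Complex.two_cos]
        linear_combination e3 - e4

/-- The angles `(2 j + s) π / m`. -/
noncomputable def angle (m s j : ℕ) : ℝ := (2 * j + s) * Real.pi / m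

/-- For `y = 2 cos w` the two products are `2 cos(mw) + 2` and `2 cos(mw) - 2`. -/
lemma prod_sub_two_cos_angle {m : ℕ} (hm : 0 < m) (y : ℂ) :
    ∏ j : Fin m, (y - 2 * (Real.cos (angle m 1 j) : ℂ)) -
      ∏ j : Fin m, (y - 2 * (Real.cos (angle m 0 j) : ℂ)) = 4 := by
  obtain ⟨w, hw⟩ := Complex.cos_surjective (y / 2)
  have hy : y = Complex.exp (w * Complex.I) + (Complex.exp (w * Complex.I))⁻¹ := by
    rw [← Complex.exp_neg, ← neg_mul, ← Complex.two_cos, hw]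
    ring
  have hm' : (m : ℂ) ≠ 0 := by exact_mod_cast hm.ne'
  have key : ∀ s : ℕ, ∏ j : Fin m, (y - 2 * (Real.cos (angle m s j) : ℂ)) =
      Complex.exp (w * Complex.I) ^ m + (Complex.exp (w * Complex.I))⁻¹ ^ m -
        2 * Complex.cos (s * Real.pi) := by
    intro s
    rw [Fin.prod_univ_eq_prod_range (fun j => y - 2 * (Real.cos (angle m s j) : ℂ)) m]
    have := prod_add_inv_sub_two_cos hm (s * Real.pi / m) _ (Complex.exp_ne_zero (w * Complex.I))
    rw [← hy, mul_div_cancel₀ _ hm'] at this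
    rw [← this]
    refine Finset.prod_congr rfl fun j _ => ?_
    rw [angle, Complex.ofReal_cos]
    congr 3
    push_cast
    ring
  rw [key, key]
  simp
  ring

/-! ### Frobenius geometry and separation of orthogonal orbits -/

section Frobenius
attribute [local instance] Matrix.frobeniusNormedAddCommGroup

lemma frobNorm_eq_norm {r : ℕ} (M : Matrix (Fin r) (Fin r) ℝ) : frobNorm M = ‖M‖ := by
  rw [frobNorm, Matrix.frobenius_norm_def, Real.sqrt_eq_rpow]
  simp

lemma frobNorm_sub_le {r : ℕ} (M N P : Matrix (Fin r) (Fin r) ℝ) :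
    frobNorm (M - N) ≤ frobNorm (M - P) + frobNorm (N - P) := by
  simp_rw [frobNorm_eq_norm]
  rw [norm_sub_rev N P]
  exact norm_sub_le_norm_sub_add_norm_sub M P N

end Frobenius

lemma frobNorm_nonneg {r : ℕ} (M : Matrix (Fin r) (Fin r) ℝ) : 0 ≤ frobNorm M :=
  Real.sqrt_nonneg _

lemma sum_sq_eq_trace {r : ℕ} (M : Matrix (Fin r) (Fin r) ℝ) :
    ∑ i, ∑ j, M i j ^ 2 = (Mᵀ * M).trace := by
  rw [Finset.sum_comm, Matrix.trace]
  refine Finset.sum_congr rfl fun j _ => ?_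
  rw [Matrix.diag_apply, Matrix.mul_apply]
  exact Finset.sum_congr rfl fun i _ => by rw [Matrix.transpose_apply, sq]

lemma frobNorm_orthogonal_mul {r : ℕ} {U : Matrix (Fin r) (Fin r) ℝ} (hU : Uᵀ * U = 1)
    (M : Matrix (Fin r) (Fin r) ℝ) : frobNorm (U * M) = frobNorm M := by
  rw [frobNorm, frobNorm, sum_sq_eq_trace, sum_sq_eq_trace, Matrix.transpose_mul, Matrix.mul_assoc,
    ← Matrix.mul_assoc Uᵀ, hU, Matrix.one_mul]

lemma frobNorm_mul_orthogonal {r : ℕ} {U : Matrix (Fin r) (Fin r) ℝ} (hU : U * Uᵀ = 1)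
    (M : Matrix (Fin r) (Fin r) ℝ) : frobNorm (M * U) = frobNorm M := by
  rw [frobNorm, frobNorm, sum_sq_eq_trace, sum_sq_eq_trace, Matrix.transpose_mul,
    Matrix.mul_assoc, Matrix.trace_mul_comm, Matrix.mul_assoc, Matrix.mul_assoc, hU, Matrix.mul_one]

lemma transpose_mul_self_of_orthogonal {r : ℕ} (U : Matrix.orthogonalGroup (Fin r) ℝ) :
    U.1ᵀ * U.1 = 1 := by
  have := (Matrix.mem_orthogonalGroup_iff' (Fin r) ℝ).1 U.2
  simpa [Matrix.star_eq_conjTranspose] using this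

lemma mul_transpose_self_of_orthogonal {r : ℕ} (U : Matrix.orthogonalGroup (Fin r) ℝ) :
    U.1 * U.1ᵀ = 1 := by
  have := (Matrix.mem_orthogonalGroup_iff (Fin r) ℝ).1 U.2
  simpa [Matrix.star_eq_conjTranspose] using this

/-- If an eigenvalue of one diagonal matrix is `g`-separated from the spectrum of another one, then
all orthogonal conjugates of the two matrices are at Frobenius distance at least `g`. -/
lemma le_frobNorm_conj_sub_conj {r : ℕ} (d d' : Fin r → ℝ) (i₀ : Fin r) {g : ℝ} (hg : 0 ≤ g)
    (h : ∀ i, g ≤ |d i₀ - d' i|) (U V : Matrix.orthogonalGroup (Fin r) ℝ) :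
    g ≤ frobNorm (U.1 * Matrix.diagonal d * U.1ᵀ - V.1 * Matrix.diagonal d' * V.1ᵀ) := by
  set W : Matrix (Fin r) (Fin r) ℝ := V.1ᵀ * U.1 with hW
  have hU := transpose_mul_self_of_orthogonal U
  have hV := transpose_mul_self_of_orthogonal V
  have hWW : Wᵀ * W = 1 := by
    rw [hW, Matrix.transpose_mul, Matrix.transpose_transpose, Matrix.mul_assoc,
      ← Matrix.mul_assoc V.1, mul_transpose_self_of_orthogonal V, Matrix.one_mul, hU]
  have hconj : frobNorm (U.1 * Matrix.diagonal d * U.1ᵀ - V.1 * Matrix.diagonal d' * V.1ᵀ) =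
      frobNorm (W * Matrix.diagonal d - Matrix.diagonal d' * W) := by
    rw [← frobNorm_mul_orthogonal (mul_transpose_self_of_orthogonal U),
      ← frobNorm_orthogonal_mul (U := V.1ᵀ)
        (by rw [Matrix.transpose_transpose]; exact mul_transpose_self_of_orthogonal V)]
    congr 1
    rw [Matrix.sub_mul, Matrix.mul_sub]
    congr 1
    · rw [Matrix.mul_assoc _ U.1ᵀ, hU, Matrix.mul_one, hW, Matrix.mul_assoc]
    · rw [Matrix.mul_assoc (V.1 * _), Matrix.mul_assoc V.1, ← Matrix.mul_assoc V.1ᵀ, hV,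
        Matrix.one_mul, hW]
  have hcol : ∑ i, W i i₀ ^ 2 = 1 := by
    have := congrFun (congrFun hWW i₀) i₀
    rw [Matrix.mul_apply, Matrix.one_apply_eq] at this
    rw [← this]
    exact Finset.sum_congr rfl fun i _ => by rw [Matrix.transpose_apply, sq]
  rw [hconj, frobNorm]
  refine Real.le_sqrt_of_sq_le ?_
  -- Column `i₀` of `W D - D' W` has entries `W i i₀ (d i₀ - d' i)`, and column `i₀` of `W` is a
  -- unit vector.
  calc g ^ 2 = ∑ i, W i i₀ ^ 2 * g ^ 2 := by rw [← Finset.sum_mul, hcol, one_mul]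
    _ ≤ ∑ i, (W * Matrix.diagonal d - Matrix.diagonal d' * W) i i₀ ^ 2 := by
        refine Finset.sum_le_sum fun i _ => ?_
        rw [Matrix.sub_apply, Matrix.mul_diagonal, Matrix.diagonal_mul,
          show W i i₀ * d i₀ - d' i * W i i₀ = W i i₀ * (d i₀ - d' i) by ring, mul_pow]
        refine mul_le_mul_of_nonneg_left ?_ (sq_nonneg _)
        rw [← sq_abs (d i₀ - d' i)]
        exact pow_le_pow_left₀ hg (h i) 2
    _ ≤ _ := Finset.sum_le_sum fun i _ =>
        Finset.single_le_sum (f := fun j => (W * Matrix.diagonal d - Matrix.diagonal d' * W) i j ^ 2)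
          (fun j _ => sq_nonneg _) (Finset.mem_univ i₀)

lemma exists_frobNorm_lt_of_paramDist_lt {r : ℕ} {Q Q' : Matrix (Fin r) (Fin r) ℝ} {a : ℝ}
    (h : paramDist Q Q' < a) :
    ∃ U : Matrix.orthogonalGroup (Fin r) ℝ, frobNorm (U.1 * Q * U.1ᵀ - Q') < a :=
  exists_lt_of_ciInf_lt h

lemma not_paramDist_le_both {r : ℕ} (d d' : Fin r → ℝ) (i₀ : Fin r) {g ε : ℝ} (hε : 0 < ε)
    (h : ∀ i, g ≤ |d i₀ - d' i|) (hg : 2 * ε < g) (Q : Matrix (Fin r) (Fin r) ℝ)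
    (hd : paramDist (Matrix.diagonal d) Q ≤ ε) : ¬ paramDist (Matrix.diagonal d') Q ≤ ε := by
  intro hd'
  -- The strict inequality `2 * ε < g` leaves room for near-minimizers, so attainment of the infimum
  -- is not needed.
  obtain ⟨U, hU⟩ := exists_frobNorm_lt_of_paramDist_lt (a := g / 2)
    (show paramDist (Matrix.diagonal d) Q < g / 2 by linarith)
  obtain ⟨V, hV⟩ := exists_frobNorm_lt_of_paramDist_lt (a := g / 2)
    (show paramDist (Matrix.diagonal d') Q < g / 2 by linarith)
  have h1 := le_frobNorm_conj_sub_conj d d' i₀ (by linarith) h U V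
  have h2 := frobNorm_sub_le (U.1 * Matrix.diagonal d * U.1ᵀ) (V.1 * Matrix.diagonal d' * V.1ᵀ) Q
  linarith

/-- An infimum of continuous functions is upper semicontinuous, even over an uncountable family. -/
lemma measurable_paramDist {r : ℕ} (Q : Matrix (Fin r) (Fin r) ℝ) : Measurable (paramDist Q) := by
  have : BorelSpace (Matrix (Fin r) (Fin r) ℝ) :=
    inferInstanceAs (BorelSpace (Fin r → Fin r → ℝ))
  refine UpperSemicontinuous.measurable (upperSemicontinuous_ciInf
    (fun Q' => ⟨0, ?_⟩) fun U => Continuous.upperSemicontinuous ?_)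
  · rintro _ ⟨U, rfl⟩
    exact frobNorm_nonneg _
  · unfold frobNorm
    refine Real.continuous_sqrt.comp (continuous_finsetSum _ fun i _ =>
      continuous_finsetSum _ fun j _ => ?_)
    exact (continuous_const.sub (continuous_id.matrix_elem i j)).pow 2

lemma diagonal_mem_boundedForms {r k : ℕ} (hk : 1 ≤ k) (hr : 1 ≤ r) (d : Fin r → ℝ)
    (hd : ∀ i, |d i| ≤ r) : Matrix.diagonal d ∈ boundedForms r k := by
  refine ⟨Matrix.isSymm_diagonal d, ?_⟩
  have h1 : ‖Matrix.toEuclideanCLM (n := Fin r) (𝕜 := ℝ) (Matrix.diagonal d)‖ ≤ r := by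
    refine ContinuousLinearMap.opNorm_le_bound _ (Nat.cast_nonneg r) fun x => ?_
    rw [EuclideanSpace.norm_eq, EuclideanSpace.norm_eq, ← Real.sqrt_sq (Nat.cast_nonneg (α := ℝ) r),
      ← Real.sqrt_mul (sq_nonneg _), Finset.mul_sum]
    refine Real.sqrt_le_sqrt (Finset.sum_le_sum fun i _ => ?_)
    rw [Matrix.ofLp_toEuclideanCLM, Matrix.mulVec_diagonal, norm_mul, mul_pow]
    exact mul_le_mul_of_nonneg_right (pow_le_pow_left₀ (norm_nonneg _) (hd i) 2) (sq_nonneg _)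
  exact h1.trans (le_self_pow₀ (by exact_mod_cast hr) (by omega))

/-! ### Comparison of measures through characteristic functions -/

lemma integrable_charFun_integrand (μ : Measure ℝ) [IsFiniteMeasure μ] (t : ℝ) :
    Integrable (fun x : ℝ => Complex.exp (t * x * Complex.I)) μ := by
  refine Integrable.of_bound (by fun_prop) 1 (Filter.Eventually.of_forall fun x => ?_)
  rw [← Complex.ofReal_mul, Complex.norm_exp_ofReal_mul_I]

lemma charFun_add_sum_smul {ι : Type*} (s : Finset ι) (μ : Measure ℝ) [IsFiniteMeasure μ]
    (W : ι → Measure ℝ) [∀ i, IsFiniteMeasure (W i)] (a : ι → NNReal) (t : ℝ) :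
    charFun (μ + ∑ i ∈ s, a i • W i) t =
      charFun μ t + ∑ i ∈ s, ((a i : ℝ) : ℂ) * charFun (W i) t := by
  simp_rw [charFun_apply_real]
  rw [integral_add_measure (integrable_charFun_integrand _ t) (integrable_charFun_integrand _ t),
    integral_finsetSum_measure fun i _ => integrable_charFun_integrand _ t]
  simp_rw [integral_smul_nnreal_measure, NNReal.smul_def, Complex.real_smul]

/-- If the difference of two characteristic functions is a real linear combination of
characteristic functions, the measures differ by at most the positive part of the combination. -/
lemma le_add_sum_of_charFun_sub {ι : Type*} (s : Finset ι) (μ ν : Measure ℝ) [IsFiniteMeasure μ]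
    [IsFiniteMeasure ν] (W : ι → Measure ℝ) [∀ i, IsFiniteMeasure (W i)] (a : ι → ℝ)
    (h : ∀ t, charFun μ t - charFun ν t = ∑ i ∈ s, (a i : ℂ) * charFun (W i) t) :
    μ ≤ ν + ∑ i ∈ s, (a i).toNNReal • W i := by
  -- Moving the negative coefficients to the left leaves finite positive measures on both sides,
  -- which their characteristic functions determine.
  have key : μ + ∑ i ∈ s, (-a i).toNNReal • W i = ν + ∑ i ∈ s, (a i).toNNReal • W i := by
    refine Measure.ext_of_charFun (funext fun t => ?_)
    rw [charFun_add_sum_smul, charFun_add_sum_smul, ← sub_eq_zero]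
    have hsplit : ∑ i ∈ s, (a i : ℂ) * charFun (W i) t =
        ∑ i ∈ s, (((a i).toNNReal : ℝ) : ℂ) * charFun (W i) t -
          ∑ i ∈ s, (((-a i).toNNReal : ℝ) : ℂ) * charFun (W i) t := by
      rw [← Finset.sum_sub_distrib]
      refine Finset.sum_congr rfl fun i _ => ?_
      rw [← sub_mul, ← Complex.ofReal_sub]
      congr 2
      rw [Real.coe_toNNReal', Real.coe_toNNReal']
      exact (max_zero_sub_max_neg_zero_eq_self (a i)).symm
    linear_combination h t + hsplit
  rw [← key]
  exact Measure.le_add_right le_rfl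

/-- Hybrid argument: `μ` is replaced by `ν` one coordinate at a time, at cost `η` each. -/
lemma lintegral_pi_le_add {μ ν κ : Measure ℝ} [IsProbabilityMeasure μ] [IsProbabilityMeasure ν]
    (hle : μ ≤ ν + κ) {η : ENNReal} (hκ : κ Set.univ ≤ η) (n : ℕ) :
    ∀ f : (Fin n → ℝ) → ENNReal, Measurable f → (∀ x, f x ≤ 1) →
      ∫⁻ x, f x ∂(Measure.pi fun _ => μ) ≤ ∫⁻ x, f x ∂(Measure.pi fun _ => ν) + n * η := by
  induction n with
  | zero =>
    intro f _ _
    rw [Measure.pi_of_empty, Measure.pi_of_empty]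
    exact le_self_add
  | succ n ih =>
    intro f hf hf1
    let e := (MeasurableEquiv.piFinSuccAbove (fun _ : Fin (n + 1) => ℝ) 0).symm
    have hfe : Measurable fun p => f (e p) := hf.comp e.measurable
    have hpi : ∀ (ρ : Measure ℝ) [IsProbabilityMeasure ρ],
        ∫⁻ x, f x ∂(Measure.pi fun _ : Fin (n + 1) => ρ) =
          ∫⁻ x, ∫⁻ y, f (e (x, y)) ∂(Measure.pi fun _ : Fin n => ρ) ∂ρ := by
      intro ρ _
      rw [← ((measurePreserving_piFinSuccAbove (fun _ : Fin (n + 1) => ρ) 0).symm).lintegral_comp hf]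
      exact lintegral_prod _ hfe.aemeasurable
    have hh : Measurable fun x => ∫⁻ y, f (e (x, y)) ∂(Measure.pi fun _ : Fin n => ν) :=
      hfe.lintegral_prod_right'
    have hh1 : ∀ x, ∫⁻ y, f (e (x, y)) ∂(Measure.pi fun _ : Fin n => ν) ≤ 1 := fun x =>
      (lintegral_mono fun y => hf1 _).trans (by simp)
    rw [hpi μ, hpi ν]
    calc ∫⁻ x, ∫⁻ y, f (e (x, y)) ∂(Measure.pi fun _ : Fin n => μ) ∂μ
        ≤ ∫⁻ x, (∫⁻ y, f (e (x, y)) ∂(Measure.pi fun _ : Fin n => ν) + n * η) ∂μ :=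
          lintegral_mono fun x => ih _ (hfe.comp measurable_prodMk_left) fun y => hf1 _
      _ = ∫⁻ x, ∫⁻ y, f (e (x, y)) ∂(Measure.pi fun _ : Fin n => ν) ∂μ + n * η := by
          rw [lintegral_add_right _ measurable_const, lintegral_const, measure_univ, mul_one]
      _ ≤ ∫⁻ x, ∫⁻ y, f (e (x, y)) ∂(Measure.pi fun _ : Fin n => ν) ∂(ν + κ) + n * η := by
          gcongr
      _ ≤ ∫⁻ x, ∫⁻ y, f (e (x, y)) ∂(Measure.pi fun _ : Fin n => ν) ∂ν + η + n * η := by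
          rw [lintegral_add_measure]
          gcongr
          exact (lintegral_mono hh1).trans (by simpa using hκ)
      _ = _ := by
          push_cast
          ring

/-! ### The two spectra and the closeness of their laws -/

/-- Two families of eigenvalues (`s = 0` and `s = 1`): shifted Chebyshev-type nodes, whose
elementary symmetric polynomials agree except for the product. -/
noncomputable def nodes (A : ℝ) (m s : ℕ) (j : Fin m) : ℝ := 3 * A + A * (2 * Real.cos (angle m s j))

lemma abs_nodes_le {A : ℝ} (hA : 0 ≤ A) (m s : ℕ) (j : Fin m) : |nodes A m s j| ≤ 6 * A := by
  rw [nodes, abs_le]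
  constructor <;> nlinarith [Real.neg_one_le_cos (angle m s j), Real.cos_le_one (angle m s j)]

lemma prod_one_sub_nodes {A : ℝ} (hA : A ≠ 0) {m : ℕ} (hm : 0 < m) (τ : ℂ) :
    ∏ j, (1 - nodes A m 1 j * τ) - ∏ j, (1 - nodes A m 0 j * τ) = 4 * (A * τ) ^ m := by
  rcases eq_or_ne τ 0 with rfl | hτ
  · simp [hm.ne']
  have hA' : (A : ℂ) ≠ 0 := by exact_mod_cast hA
  have key : ∀ s : ℕ, ∏ j, (1 - nodes A m s j * τ) =
      (A * τ) ^ m * ∏ j : Fin m, ((1 / τ - 3 * A) / A - 2 * (Real.cos (angle m s j) : ℂ)) := by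
    intro s
    have hc : (A * τ) ^ m = ∏ _j : Fin m, (A * τ) := by
      rw [Finset.prod_const, Finset.card_univ, Fintype.card_fin]
    rw [hc, ← Finset.prod_mul_distrib]
    refine Finset.prod_congr rfl fun j _ => ?_
    rw [nodes]
    push_cast
    field_simp
    ring
  rw [key, key, ← mul_sub, prod_sub_two_cos_angle hm]
  ring

/-- The diagonal entries: each node and `m` copies of `6 A` twice, padded by zeros. -/
noncomputable def paddedNodes (A : ℝ) (m s : ℕ) {q : ℕ} : ((Fin m ⊕ Fin m) × Fin 2) ⊕ Fin q → ℝ :=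
  Sum.elim (fun p => Sum.elim (nodes A m s) (fun _ => 6 * A) p.1) fun _ => 0

lemma charFun_paddedNodes {ι : Type*} [Fintype ι] (A : ℝ) (m s q : ℕ)
    (e : ι ≃ ((Fin m ⊕ Fin m) × Fin 2) ⊕ Fin q) (t : ℝ) :
    charFun (weightedSqLaw (paddedNodes A m s ∘ e)) t =
      (∏ j, (1 - nodes A m s j * (2 * t * Complex.I)))⁻¹ *
        ((1 - ((6 * A : ℝ) : ℂ) * (2 * t * Complex.I))⁻¹) ^ m := by
  rw [charFun_weightedSqLaw]
  simp only [Function.comp_apply]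
  rw [e.prod_comp fun x => charFunSq (t * paddedNodes A m s x), Fintype.prod_sum_type]
  simp only [paddedNodes, Sum.elim_inl, Sum.elim_inr, mul_zero, charFunSq_zero, Finset.prod_const_one,
    mul_one]
  rw [prod_charFunSq_fin_two, Fintype.prod_sum_type]
  simp only [Sum.elim_inl, Sum.elim_inr, Finset.prod_const, Finset.card_univ, Fintype.card_fin,
    Finset.prod_inv_distrib]

/-- The law of the quadratic form with both families of nodes and `i` copies of `6 A`. -/
noncomputable def mixedLaw (A : ℝ) (m i : ℕ) : Measure ℝ :=
  weightedSqLaw fun p : (Fin m ⊕ Fin m ⊕ Fin i) × Fin 2 =>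
    Sum.elim (nodes A m 0) (Sum.elim (nodes A m 1) fun _ => 6 * A) p.1

instance (A : ℝ) (m i : ℕ) : IsProbabilityMeasure (mixedLaw A m i) := by
  unfold mixedLaw
  infer_instance

lemma charFun_mixedLaw (A : ℝ) (m i : ℕ) (t : ℝ) :
    charFun (mixedLaw A m i) t =
      (∏ j, (1 - nodes A m 0 j * (2 * t * Complex.I)))⁻¹ *
        (∏ j, (1 - nodes A m 1 j * (2 * t * Complex.I)))⁻¹ *
        ((1 - ((6 * A : ℝ) : ℂ) * (2 * t * Complex.I))⁻¹) ^ i := by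
  rw [mixedLaw, charFun_weightedSqLaw, prod_charFunSq_fin_two, Fintype.prod_sum_type,
    Fintype.prod_sum_type]
  simp only [Sum.elim_inl, Sum.elim_inr, Finset.prod_const, Finset.card_univ, Fintype.card_fin,
    Finset.prod_inv_distrib, mul_assoc]

lemma one_sub_mul_two_I_ne_zero (x t : ℝ) : (1 : ℂ) - x * (2 * t * Complex.I) ≠ 0 := by
  intro h
  simpa using congrArg Complex.re h

/-- The copies of `6A` supply the factor `u^m` that turns the unbounded `τ^m` into a polynomial in
`u`, hence into genuine characteristic functions. -/
lemma charFun_paddedNodes_sub {ι : Type*} [Fintype ι] {A : ℝ} (hA : A ≠ 0) {m : ℕ} (hm : 0 < m)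
    (q : ℕ) (e : ι ≃ ((Fin m ⊕ Fin m) × Fin 2) ⊕ Fin q) (t : ℝ) :
    charFun (weightedSqLaw (paddedNodes A m 0 ∘ e)) t -
        charFun (weightedSqLaw (paddedNodes A m 1 ∘ e)) t =
      ∑ i ∈ Finset.range (m + 1),
        ((4 / 6 ^ m * ((-1) ^ (m - i) * m.choose i) : ℝ) : ℂ) * charFun (mixedLaw A m i) t := by
  simp_rw [charFun_paddedNodes, charFun_mixedLaw]
  have hP := prod_one_sub_nodes hA hm (2 * t * Complex.I)
  have hP0 : ∏ j, (1 - nodes A m 0 j * (2 * t * Complex.I)) ≠ 0 :=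
    Finset.prod_ne_zero_iff.2 fun j _ => one_sub_mul_two_I_ne_zero _ _
  have hP1 : ∏ j, (1 - nodes A m 1 j * (2 * t * Complex.I)) ≠ 0 :=
    Finset.prod_ne_zero_iff.2 fun j _ => one_sub_mul_two_I_ne_zero _ _
  have hK := one_sub_mul_two_I_ne_zero (6 * A) t
  set τ : ℂ := 2 * t * Complex.I
  set P0 := ∏ j, (1 - nodes A m 0 j * τ)
  set P1 := ∏ j, (1 - nodes A m 1 j * τ)
  set u : ℂ := (1 - ((6 * A : ℝ) : ℂ) * τ)⁻¹ with hu
  have hu1 : u + -1 = 6 * (A * τ) * u := by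
    rw [hu]
    field_simp
    push_cast
    ring
  have hsum : ∑ i ∈ Finset.range (m + 1),
        ((4 / 6 ^ m * ((-1) ^ (m - i) * m.choose i) : ℝ) : ℂ) * (P0⁻¹ * P1⁻¹ * u ^ i) =
      4 / 6 ^ m * (P0⁻¹ * P1⁻¹) * (u + -1) ^ m := by
    rw [add_pow, Finset.mul_sum]
    refine Finset.sum_congr rfl fun i _ => ?_
    push_cast
    ring
  rw [hsum, hu1, mul_pow, mul_pow 6]
  have h6 : (6 : ℂ) ^ m ≠ 0 := pow_ne_zero _ (by norm_num)
  have hsub : P0⁻¹ * u ^ m - P1⁻¹ * u ^ m = P0⁻¹ * P1⁻¹ * u ^ m * (P1 - P0) := by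
    field_simp
  rw [hsub, hP]
  field_simp

lemma weightedSqLaw_paddedNodes_le {ι : Type*} [Fintype ι] {A : ℝ} (hA : A ≠ 0) {m : ℕ}
    (hm : 0 < m) (q : ℕ) (e : ι ≃ ((Fin m ⊕ Fin m) × Fin 2) ⊕ Fin q) :
    ∃ κ : Measure ℝ, κ Set.univ ≤ ENNReal.ofReal (4 / 3 ^ m) ∧
      weightedSqLaw (paddedNodes A m 0 ∘ e) ≤ weightedSqLaw (paddedNodes A m 1 ∘ e) + κ := by
  refine ⟨_, ?_, le_add_sum_of_charFun_sub _ _ _ _ _ (charFun_paddedNodes_sub hA hm q e)⟩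
  rw [Measure.coe_finsetSum, Finset.sum_apply]
  calc ∑ i ∈ Finset.range (m + 1), ((4 / 6 ^ m * ((-1) ^ (m - i) * m.choose i) : ℝ).toNNReal •
        mixedLaw A m i) Set.univ
      ≤ ∑ i ∈ Finset.range (m + 1), ENNReal.ofReal (4 / 6 ^ m * m.choose i) := by
        refine Finset.sum_le_sum fun i _ => ?_
        rw [Measure.smul_apply, measure_univ, ENNReal.smul_def, smul_eq_mul, mul_one]
        refine ENNReal.ofReal_le_ofReal (mul_le_mul_of_nonneg_left ?_ (by positivity))
        refine (le_abs_self _).trans ?_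
        rw [abs_mul, abs_pow, abs_neg, abs_one, one_pow, one_mul, Nat.abs_cast]
    _ = ENNReal.ofReal (4 / 3 ^ m) := by
        rw [← ENNReal.ofReal_sum_of_nonneg fun i _ => by positivity, ← Finset.mul_sum,
          ← Nat.cast_sum, Nat.sum_range_choose]
        congr 1
        rw [show (6 : ℝ) = 2 * 3 by norm_num, mul_pow]
        push_cast
        field_simp

/-! ### Separation of the two spectra -/

lemma abs_sin_natCast_mul_le (n : ℕ) (x : ℝ) : |Real.sin (n * x)| ≤ n * |Real.sin x| := by
  induction n with
  | zero => simp
  | succ n ih =>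
    push_cast
    rw [add_mul, one_mul, Real.sin_add, add_mul, one_mul]
    refine (abs_add_le _ _).trans (add_le_add ?_ ?_)
    · rw [abs_mul]
      exact (mul_le_of_le_one_right (abs_nonneg _) (Real.abs_cos_le_one _)).trans ih
    · rw [abs_mul]
      exact mul_le_of_le_one_left (abs_nonneg _) (Real.abs_cos_le_one _)

lemma cos_angle_zero {l : ℕ} (hl : 0 < l) : Real.cos (angle (4 * l) 0 l) = 0 := by
  have hl' : (l : ℝ) ≠ 0 := by exact_mod_cast hl.ne'
  rw [← Real.cos_pi_div_two, angle]
  congr 1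
  push_cast
  field_simp
  ring

/-- With `φ = π/2 - θ`, `2lφ` is an odd multiple of `π/2`, so `1 = |sin(2lφ)| ≤ 2l |sin φ| = 2l |cos
θ|`. -/
lemma le_abs_cos_angle_one {l : ℕ} (hl : 0 < l) (j : ℕ) :
    1 / (2 * l) ≤ |Real.cos (angle (4 * l) 1 j)| := by
  have hl' : (l : ℝ) ≠ 0 := by exact_mod_cast hl.ne'
  have hl0 : (0 : ℝ) < l := by exact_mod_cast hl
  set φ := Real.pi / 2 - angle (4 * l) 1 j with hφ
  have h0 : Real.cos ((2 * l : ℕ) * φ) = 0 := by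
    rw [Real.cos_eq_zero_iff]
    refine ⟨l - j - 1, ?_⟩
    rw [hφ, angle]
    push_cast
    field_simp
    ring
  have h1 : |Real.sin ((2 * l : ℕ) * φ)| = 1 := by
    have := Real.sin_sq_add_cos_sq ((2 * l : ℕ) * φ)
    rw [h0] at this
    refine (sq_eq_sq₀ (abs_nonneg _) zero_le_one).1 ?_
    rw [sq_abs]
    linarith
  have h2 := abs_sin_natCast_mul_le (2 * l) φ
  rw [h1, hφ, Real.sin_pi_div_two_sub] at h2
  push_cast at h2
  rw [div_le_iff₀ (by positivity)]
  linarith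

lemma abs_paddedNodes_le {A : ℝ} (hA : 0 ≤ A) (m s : ℕ) {q : ℕ}
    (x : ((Fin m ⊕ Fin m) × Fin 2) ⊕ Fin q) : |paddedNodes A m s x| ≤ 6 * A := by
  rcases x with ⟨j | j, b⟩ | x
  · exact abs_nodes_le hA m s j
  · exact (abs_of_nonneg (by positivity : (0 : ℝ) ≤ 6 * A)).le
  · simpa [paddedNodes] using hA

/-- The shift by `3A` in the nodes keeps the distinguished eigenvalue away from the padding `0` as
well as from `6A`. -/
lemma div_le_abs_three_mul_sub_paddedNodes {A : ℝ} (hA : 0 ≤ A) {l : ℕ} (hl : 0 < l) {q : ℕ}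
    (x : ((Fin (4 * l) ⊕ Fin (4 * l)) × Fin 2) ⊕ Fin q) :
    A / l ≤ |3 * A - paddedNodes A (4 * l) 1 x| := by
  have hAl : A / l ≤ A := div_le_self hA (by exact_mod_cast hl)
  rcases x with ⟨j | j, b⟩ | x
  · have h : 3 * A - paddedNodes A (4 * l) 1 (q := q) (Sum.inl (Sum.inl j, b)) =
        -(2 * A * Real.cos (angle (4 * l) 1 j)) := by
      simp only [paddedNodes, Sum.elim_inl, nodes]
      ring
    rw [h, abs_neg, abs_mul, abs_of_nonneg (by positivity : 0 ≤ 2 * A)]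
    calc A / l = 2 * A * (1 / (2 * l)) := by field_simp
      _ ≤ _ := mul_le_mul_of_nonneg_left (le_abs_cos_angle_one hl j) (by positivity)
  · have h : 3 * A - paddedNodes A (4 * l) 1 (q := q) (Sum.inl (Sum.inr j, b)) = -(3 * A) := by
      simp only [paddedNodes, Sum.elim_inl, Sum.elim_inr]
      ring
    rw [h, abs_neg]
    exact le_trans (by linarith) (le_abs_self _)
  · have h : 3 * A - paddedNodes A (4 * l) 1 (q := q) (Sum.inr x) = 3 * A := by
      simp only [paddedNodes, Sum.elim_inr, sub_zero]
    rw [h]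
    exact le_trans (by linarith) (le_abs_self _)

/-! ### Two-point method and choice of parameters -/

/-- Le Cam's two-point method: no algorithm can learn two well separated forms when the laws of the
samples are close. -/
lemma one_sub_le_of_paramLearns {r n : ℕ} (A : Kernel (Fin n → ℝ) (Matrix (Fin r) (Fin r) ℝ))
    [IsMarkovKernel A] {ε δ : ℝ} {Q Q' : Matrix (Fin r) (Fin r) ℝ}
    [IsProbabilityMeasure (quadTransformation Q)] [IsProbabilityMeasure (quadTransformation Q')]
    (hdisj : ∀ M, paramDist Q M ≤ ε → ¬ paramDist Q' M ≤ ε) {κ : Measure ℝ} {η : ℝ} (hη : 0 ≤ η)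
    (hκ : κ Set.univ ≤ ENNReal.ofReal η) (hle : quadTransformation Q ≤ quadTransformation Q' + κ)
    (h : ParamLearns A ε δ Q) (h' : ParamLearns A ε δ Q') : 1 - 2 * δ ≤ n * η := by
  have hS : ∀ P : Matrix (Fin r) (Fin r) ℝ, MeasurableSet {M | paramDist P M ≤ ε} := fun P =>
    measurableSet_le (measurable_paramDist P) measurable_const
  set μ := (Measure.pi fun _ : Fin n => quadTransformation Q).bind A with hμ
  set ν := (Measure.pi fun _ : Fin n => quadTransformation Q').bind A with hν
  have hprob : IsProbabilityMeasure ν := by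
    rw [hν]
    infer_instance
  -- Randomization is harmless: the test function is the `[0, 1]`-valued probability that `A`
  -- outputs a point of the set.
  have hcomp : μ {M | paramDist Q M ≤ ε} ≤ ν {M | paramDist Q M ≤ ε} + n * ENNReal.ofReal η := by
    rw [hμ, hν, Measure.bind_apply (hS Q) A.measurable.aemeasurable,
      Measure.bind_apply (hS Q) A.measurable.aemeasurable]
    exact lintegral_pi_le_add hle hκ n _ (A.measurable_coe (hS Q)) fun x => prob_le_one
  have hreal : μ.real {M | paramDist Q M ≤ ε} ≤ ν.real {M | paramDist Q M ≤ ε} + n * η := by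
    have hfin : (n : ENNReal) * ENNReal.ofReal η ≠ ⊤ :=
      ENNReal.mul_ne_top (ENNReal.natCast_ne_top n) ENNReal.ofReal_ne_top
    have := ENNReal.toReal_mono (ENNReal.add_ne_top.2 ⟨measure_ne_top ν _, hfin⟩) hcomp
    rwa [ENNReal.toReal_add (measure_ne_top ν _) hfin, ENNReal.toReal_mul, ENNReal.toReal_natCast,
      ENNReal.toReal_ofReal hη] at this
  have hdisj' : Disjoint {M | paramDist Q M ≤ ε} {M | paramDist Q' M ≤ ε} :=
    Set.disjoint_left.2 hdisj
  have hunion : ν.real {M | paramDist Q M ≤ ε} + ν.real {M | paramDist Q' M ≤ ε} ≤ 1 := by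
    rw [← measureReal_union hdisj' (hS Q')]
    exact measureReal_le_one
  have h1 : 1 - δ ≤ μ.real {M | paramDist Q M ≤ ε} := h
  have h2 : 1 - δ ≤ ν.real {M | paramDist Q' M ≤ ε} := h'
  linarith

lemma one_sub_le_mul_of_forall_paramLearns {r n k l : ℕ} (hk : 1 ≤ k) (hl : 0 < l)
    (hlr : 16 * l ≤ r) {ε δ : ℝ} (hε : 0 < ε) (hsep : 12 * ε * l < r)
    (A : Kernel (Fin n → ℝ) (Matrix (Fin r) (Fin r) ℝ)) [IsMarkovKernel A]
    (h : ∀ Q ∈ boundedForms r k, ParamLearns A ε δ Q) :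
    1 - 2 * δ ≤ n * (4 / 3 ^ (4 * l)) := by
  have hr : 0 < r := by omega
  have hr' : (0 : ℝ) < r := by exact_mod_cast hr
  have hl' : (0 : ℝ) < l := by exact_mod_cast hl
  let e : Fin r ≃ ((Fin (4 * l) ⊕ Fin (4 * l)) × Fin 2) ⊕ Fin (r - 16 * l) :=
    Fintype.equivOfCardEq (by
      simp only [Fintype.card_fin, Fintype.card_sum, Fintype.card_prod]
      omega)
  -- The largest eigenvalue is then at most `6a = r ≤ r ^ k`.
  set a : ℝ := r / 6 with ha
  have ha0 : 0 < a := by positivity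
  have hmem : ∀ s, Matrix.diagonal (paddedNodes a (4 * l) s ∘ e) ∈ boundedForms r k := fun s =>
    diagonal_mem_boundedForms hk hr _ fun i =>
      (abs_paddedNodes_le ha0.le _ _ _).trans (by rw [ha]; linarith)
  have hprob : ∀ s, IsProbabilityMeasure
      (quadTransformation (Matrix.diagonal (paddedNodes a (4 * l) s ∘ e))) := fun s => by
    rw [quadTransformation_diagonal]
    infer_instance
  have := hprob 0
  have := hprob 1
  obtain ⟨κ, hκ, hle⟩ := weightedSqLaw_paddedNodes_le ha0.ne' (by omega : 0 < 4 * l) _ e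
  rw [← quadTransformation_diagonal, ← quadTransformation_diagonal] at hle
  let i₀ : Fin r := e.symm (Sum.inl (Sum.inl ⟨l, by omega⟩, 0))
  have hi₀ : (paddedNodes a (4 * l) 0 ∘ e) i₀ = 3 * a := by
    simp [i₀, paddedNodes, nodes, cos_angle_zero hl]
  refine one_sub_le_of_paramLearns A (not_paramDist_le_both _ _ i₀ (g := a / l) hε (fun i => ?_) ?_)
    (by positivity) hκ hle (h _ (hmem 0)) (h _ (hmem 1))
  · rw [hi₀]
    exact div_le_abs_three_mul_sub_paddedNodes ha0.le hl _
  · rw [lt_div_iff₀ hl', ha]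
    linarith

theorem theoremB1 (k : ℕ) (hk : 1 ≤ k) (ε : ℝ) (hε : 0 < ε) :
    ∃ c : ℝ, 0 < c ∧ ∀ δ : ℝ, 0 < δ → δ < 1 / 2 → ∃ r₀ : ℕ, ∀ r : ℕ, r₀ ≤ r →
      ∀ (n : ℕ) (A : Kernel (Fin n → ℝ) (Matrix (Fin r) (Fin r) ℝ)) [IsMarkovKernel A],
        (∀ Q ∈ boundedForms r k, ParamLearns A ε δ Q) → Real.exp (c * r) ≤ n := by
  obtain ⟨C₀, hC₀⟩ := exists_nat_gt (12 * ε)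
  -- `C > 12ε` gives the separation; `C ≥ 16` leaves room for the `2 · 2 · 4l` nonzero entries.
  set C : ℕ := C₀ + 16 with hC
  have hCpos : (0 : ℝ) < C := by positivity
  have hCε : 12 * ε < C := by
    rw [hC]
    push_cast
    linarith
  refine ⟨1 / C, by positivity, fun δ _ hδ => ?_⟩
  set β : ℝ := (1 - 2 * δ) / 4 with hβ
  have hβ0 : 0 < β := by
    rw [hβ]
    linarith
  -- Since `81^l ≥ e^{2l}` and only `e^{r/C}` with `r/C ≤ l + 1` is claimed, the surplus exponent
  -- absorbs both `β` and the rounding in `l` once `r/C ≥ 2 - log β`.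
  obtain ⟨R, hR⟩ := exists_nat_gt (C * (2 - Real.log β))
  refine ⟨max C R, fun r hr n A _ h => ?_⟩
  have hrC : C ≤ r := (le_max_left _ _).trans hr
  have hrR : (R : ℝ) ≤ r := by exact_mod_cast (le_max_right _ _).trans hr
  set l : ℕ := r / C with hl
  have hl0 : 0 < l := Nat.div_pos hrC (by omega)
  have hlC : C * l ≤ r := Nat.mul_div_le r C
  have hlC' : (C : ℝ) * l ≤ r := by exact_mod_cast hlC
  have hl' : (0 : ℝ) < l := by exact_mod_cast hl0
  have hrl : (r : ℝ) / C ≤ l + 1 := by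
    rw [div_le_iff₀ hCpos]
    have : r < C * (r / C + 1) := Nat.lt_mul_div_succ r (by omega)
    have : (r : ℝ) < C * (l + 1) := by exact_mod_cast this
    linarith
  have hmain := one_sub_le_mul_of_forall_paramLearns hk hl0
    ((Nat.mul_le_mul_right l (by omega)).trans hlC) hε
    ((mul_lt_mul_of_pos_right hCε hl').trans_le hlC') A h
  have hpow : Real.exp (2 * l) ≤ 3 ^ (4 * l) := by
    rw [pow_mul, show (2 : ℝ) * l = l * 2 by ring, Real.exp_nat_mul]
    refine pow_le_pow_left₀ (Real.exp_pos _).le ?_ l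
    rw [show (2 : ℝ) = 1 + 1 by norm_num, Real.exp_add]
    nlinarith [Real.exp_one_lt_three, Real.exp_pos 1]
  have hn : β * 3 ^ (4 * l) ≤ n := by
    rw [← mul_div_assoc, le_div_iff₀ (by positivity)] at hmain
    rw [hβ]
    linarith
  have hlog : 2 - Real.log β ≤ r / C := by
    rw [le_div_iff₀ hCpos]
    linarith
  calc Real.exp (1 / C * r) ≤ Real.exp (Real.log β + 2 * l) := by
        refine Real.exp_le_exp.2 ?_
        rw [one_div_mul_eq_div]
        linarith
    _ = β * Real.exp (2 * l) := by rw [Real.exp_add, Real.exp_log hβ0]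
    _ ≤ β * 3 ^ (4 * l) := mul_le_mul_of_nonneg_left hpow hβ0.le
    _ ≤ n := hn
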